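/- Let $\mathbb F=\mathbb F_m$ be the free group on $m$ generators ($m$ a non-negative integer), let $|s|$ denote the length of the reduced word of $s\in\mathbb F$, let $n\ge 0$ be an integer, and let $S_n=\{s\in\mathbb F: |s|\le n\}$. Let $\mathcal H$ be a complex Hilbert space and $\mathcal L(\mathcal H)$ the space of bounded linear operators on it. A function $\varphi:S_n\to\mathcal L(\mathcal H)$ is called positive definite if for all $k$ and all $s_1,\dots,s_k\in S_n$ such that $s_i^{-1}s_j\in S_n$ for all $i,j$, the operator matrix $[\varphi(s_i^{-1}s_j)]_{i,j=1}^k$ is positive semidefinite as an operator on $\mathcal H^{\oplus k}$. Corollary 4.6. Suppose $\varphi:S_n\to\mathcal L(\mathcal H)$ is positive definite. Then there exist a complex Hilbert space $\mathcal K$, a unitary representation $\pi$ of $\mathbb F$ on $\mathcal K$ and a bounded linear operator $V:\mathcal H\to\mathcal K$ such that, for all $s,t\in\mathbb F$ for which $s^{-1}t$ has length at most $n$, $$\varphi(s^{-1}t)=V^*\,\pi(s^{-1}t)\,V.$$ -/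

import Mathlib

open scoped InnerProductSpace ComplexOrder

universe u

/-- The set `S_n` of all elements of the free group on `m` generators whose reduced word has
length at most `n`. -/
def wordBall (m n : ℕ) : Set (FreeGroup (Fin m)) :=
  {s | s.norm ≤ n}

section

variable {H : Type u} [NormedAddCommGroup H] [InnerProductSpace ℂ H]

/-- The operator on the Hilbert space direct sum `H ⊕ ⋯ ⊕ H` of `k` copies of `H` given by the
`k × k` operator matrix `A`, that is, `(A x)_i = ∑ j, A_{ij} x_j`. -/
noncomputable def blockOperator {k : ℕ} (A : Matrix (Fin k) (Fin k) (H →L[ℂ] H)) :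
    PiLp 2 (fun _ : Fin k => H) →L[ℂ] PiLp 2 (fun _ : Fin k => H) :=
  ((PiLp.continuousLinearEquiv 2 ℂ (fun _ : Fin k => H)).symm :
      (Fin k → H) →L[ℂ] PiLp 2 (fun _ : Fin k => H)) ∘L
    ContinuousLinearMap.pi fun i => ∑ j, A i j ∘L PiLp.proj 2 (fun _ : Fin k => H) j

theorem blockOperator_apply {k : ℕ} (A : Matrix (Fin k) (Fin k) (H →L[ℂ] H))
    (x : PiLp 2 (fun _ : Fin k => H)) (i : Fin k) :
    blockOperator A x i = ∑ j, A i j (x j) := by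
  simp [blockOperator]

/-- Let `S` be a subset of a group `G` (in practice closed under inverses). A function
`φ : S → L(H)` is positive definite if, for all `s_1, …, s_k ∈ S` such that `s_i⁻¹ s_j ∈ S` for
all `i`, `j`, the operator matrix `[φ(s_i⁻¹ s_j)]` is positive semidefinite, as an operator on
the direct sum of `k` copies of `H`. -/
def IsPositiveDefiniteOn {G : Type*} [Group G] (S : Set G) (φ : S → H →L[ℂ] H) : Prop :=
  ∀ (k : ℕ) (s : Fin k → G), (∀ i, s i ∈ S) → ∀ h : ∀ i j, (s i)⁻¹ * s j ∈ S,
    (blockOperator (Matrix.of fun i j => φ ⟨(s i)⁻¹ * s j, h i j⟩)).IsPositive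

/-- Positive semidefiniteness of an operator matrix through its quadratic form. -/
theorem blockOperator_isPositive_iff {k : ℕ} (A : Matrix (Fin k) (Fin k) (H →L[ℂ] H)) :
    (blockOperator A).IsPositive ↔ ∀ x : Fin k → H, 0 ≤ ∑ i, ∑ j, ⟪x i, A i j (x j)⟫_ℂ := by
  have key : ∀ x : PiLp 2 (fun _ : Fin k => H),
      ⟪x, blockOperator A x⟫_ℂ = ∑ i, ∑ j, ⟪x i, A i j (x j)⟫_ℂ := by
    intro x
    simp [PiLp.inner_apply, blockOperator_apply, inner_sum]
  constructor
  · intro h x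
    have h1 := h.inner_nonneg_right (WithLp.toLp 2 x)
    rw [key] at h1
    exact h1
  · intro h
    rw [ContinuousLinearMap.isPositive_iff_complex]
    intro x
    have h1 : 0 ≤ ⟪x, blockOperator A x⟫_ℂ := by
      rw [key]
      exact h x.ofLp
    have h2 : 0 ≤ ⟪blockOperator A x, x⟫_ℂ := by
      rw [← inner_conj_symm]
      exact star_nonneg_iff.mpr h1
    obtain ⟨hr, hi⟩ := Complex.nonneg_iff.mp h2
    exact ⟨Complex.ext (by simp) (by simpa using hi), hr⟩

end

/-! Let `r = n / 2`. Quotients of elements of the ball of radius `r` lie in `S_n`, so `φ(s⁻¹t)` is a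
positive kernel there and yields a Hilbert space `K` with vectors `e s x`
(`IsPositiveDefiniteOn.exists_space`). For each generator `a`, the partial map `e s x ↦ e (a s) x`
is isometric and extends to a contraction `T a`. If `n = 2r + 1`, then `T a` must also satisfy `⟪e s
x, T a (e t y)⟫ = ⟪x, φ(s⁻¹ a t) y⟫`; a larger space, built from the ball and its translate by `a`,
provides this (`IsPositiveDefiniteOn.exists_contraction_translate`).

Each `T a` dilates to a unitary on `K ⊕ K`, and freeness assembles these into a representation `π`
with no relations to check. Where `T a` preserves the norm, the dilation agrees with it, so `π s`
sends `e 1 x` to `e s x` on the ball. Cutting a word of length at most `n` into two halves, with a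
middle letter if the length is `2r + 1`, then computes its matrix coefficient. -/

/-! ### Unitary dilation of a contraction -/

section Dilation

variable {K : Type*} [NormedAddCommGroup K] [InnerProductSpace ℂ K]

/-- The operator on `K ⊕ K` sending `(x, y)` to `(A y, B x)`. -/
noncomputable def offDiagonal (A B : K →L[ℂ] K) : WithLp 2 (K × K) →L[ℂ] WithLp 2 (K × K) :=
  ((WithLp.prodContinuousLinearEquiv 2 ℂ K K).symm : (K × K) →L[ℂ] WithLp 2 (K × K)) ∘L
    (A ∘L WithLp.sndL 2 ℂ K K).prod (B ∘L WithLp.fstL 2 ℂ K K)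

/-- The operator on `K ⊕ K` sending `(x, y)` to `(x, -y)`. -/
noncomputable def signOperator (K : Type*) [NormedAddCommGroup K] [InnerProductSpace ℂ K] :
    WithLp 2 (K × K) →L[ℂ] WithLp 2 (K × K) :=
  ((WithLp.prodContinuousLinearEquiv 2 ℂ K K).symm : (K × K) →L[ℂ] WithLp 2 (K × K)) ∘L
    (WithLp.fstL 2 ℂ K K).prod (-WithLp.sndL 2 ℂ K K)

@[simp] theorem offDiagonal_apply_fst (A B : K →L[ℂ] K) (x : WithLp 2 (K × K)) :
    (offDiagonal A B x).fst = A x.snd := rfl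

@[simp] theorem offDiagonal_apply_snd (A B : K →L[ℂ] K) (x : WithLp 2 (K × K)) :
    (offDiagonal A B x).snd = B x.fst := rfl

@[simp] theorem signOperator_apply_fst (x : WithLp 2 (K × K)) :
    (signOperator K x).fst = x.fst := rfl

@[simp] theorem signOperator_apply_snd (x : WithLp 2 (K × K)) :
    (signOperator K x).snd = -x.snd := rfl

theorem norm_offDiagonal_le_one {A B : K →L[ℂ] K} (hA : ‖A‖ ≤ 1) (hB : ‖B‖ ≤ 1) :
    ‖offDiagonal A B‖ ≤ 1 := by
  refine ContinuousLinearMap.opNorm_le_bound _ zero_le_one fun x => ?_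
  have h1 : ‖A x.snd‖ ≤ ‖x.snd‖ := by simpa using A.le_of_opNorm_le hA x.snd
  have h2 : ‖B x.fst‖ ≤ ‖x.fst‖ := by simpa using B.le_of_opNorm_le hB x.fst
  rw [one_mul, ← sq_le_sq₀ (norm_nonneg _) (norm_nonneg _), WithLp.prod_norm_sq_eq_of_L2,
    WithLp.prod_norm_sq_eq_of_L2, add_comm (‖x.fst‖ ^ 2)]
  exact add_le_add (pow_le_pow_left₀ (norm_nonneg _) h1 2) (pow_le_pow_left₀ (norm_nonneg _) h2 2)

variable [CompleteSpace K]

theorem star_offDiagonal (A B : K →L[ℂ] K) :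
    star (offDiagonal A B) =
      offDiagonal (ContinuousLinearMap.adjoint B) (ContinuousLinearMap.adjoint A) := by
  rw [ContinuousLinearMap.star_eq_adjoint, eq_comm, ContinuousLinearMap.eq_adjoint_iff]
  intro x y
  simp [WithLp.prod_inner_apply, ContinuousLinearMap.adjoint_inner_left, add_comm]

/-- The operator swapping the two summands of `K ⊕ K`. -/
noncomputable def swapUnitary (K : Type*) [NormedAddCommGroup K] [InnerProductSpace ℂ K]
    [CompleteSpace K] : unitary (WithLp 2 (K × K) →L[ℂ] WithLp 2 (K × K)) :=
  ⟨offDiagonal 1 1, by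
    have h : offDiagonal (1 : K →L[ℂ] K) 1 * offDiagonal 1 1 = 1 := rfl
    have h1 : ContinuousLinearMap.adjoint (1 : K →L[ℂ] K) = 1 := star_one _
    rw [Unitary.mem_iff, star_offDiagonal, h1]
    exact ⟨h, h⟩⟩

/-- A self-adjoint contraction `S` is the real part of a unitary `S + i D`, where `D` commutes with
everything that commutes with `S ^ 2`. -/
theorem exists_unitary_eq_add_I_smul (S : K →L[ℂ] K) (hS : IsSelfAdjoint S) (hS1 : ‖S‖ ≤ 1) :
    ∃ (U : unitary (K →L[ℂ] K)) (D : K →L[ℂ] K), (U : K →L[ℂ] K) = S + Complex.I • D ∧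
      ∀ B : K →L[ℂ] K, Commute (S ^ 2) B → Commute D B := by
  -- Here `D = √(1 - S²)`, a function of `1 - S²`.
  refine ⟨⟨_, hS.self_add_I_smul_cfcSqrt_sub_sq_mem_unitary _ hS1⟩, _, rfl, fun B hB => ?_⟩
  rw [CFC.sqrt]
  exact ((Commute.one_left _).sub_left hB).cfcₙ_nnreal _

/-- Every contraction on `K` is the compression to `K ⊕ 0` of a unitary operator on `K ⊕ K`. -/
theorem exists_unitary_dilation (T : K →L[ℂ] K) (hT : ‖T‖ ≤ 1) :
    ∃ U : unitary (WithLp 2 (K × K) →L[ℂ] WithLp 2 (K × K)), ∀ x y : K,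
      ⟪(WithLp.toLp 2 (x, 0) : WithLp 2 (K × K)),
        (U : WithLp 2 (K × K) →L[ℂ] WithLp 2 (K × K)) (WithLp.toLp 2 (y, 0))⟫_ℂ = ⟪x, T y⟫_ℂ := by
  set S : WithLp 2 (K × K) →L[ℂ] WithLp 2 (K × K) :=
    offDiagonal (ContinuousLinearMap.adjoint T) T with hS
  have hSa : IsSelfAdjoint S := by
    rw [IsSelfAdjoint, hS, star_offDiagonal, ContinuousLinearMap.adjoint_adjoint]
  have hS1 : ‖S‖ ≤ 1 :=
    norm_offDiagonal_le_one (by rwa [LinearIsometryEquiv.norm_map]) hT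
  obtain ⟨U, D, hU, hD⟩ := exists_unitary_eq_add_I_smul S hSa hS1
  -- `S` is off-diagonal, so `S²` is diagonal; hence `D` is diagonal too.
  have hDcomm : Commute D (signOperator K) := by
    refine hD _ ?_
    ext x
    refine WithLp.ofLp_injective 2 (Prod.ext ?_ ?_)
    · change WithLp.fst _ = WithLp.fst _
      simp [pow_two, hS]
    · change WithLp.snd _ = WithLp.snd _
      simp [pow_two, hS]
  -- `U` sends `(y, 0)` to `(*, T y)`; the swap brings `T y` to the first coordinate.
  refine ⟨swapUnitary K * U, fun x y => ?_⟩
  set y' : WithLp 2 (K × K) := WithLp.toLp 2 (y, 0) with hy'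
  have hsign : signOperator K y' = y' := by
    refine WithLp.ofLp_injective 2 (Prod.ext rfl ?_)
    change -(0 : K) = 0
    simp
  have hfix : signOperator K (D y') = D y' := by
    have := congrArg (fun A => A y') hDcomm.eq
    simp only [mul_apply_eq_comp, hsign] at this
    exact this.symm
  have hsnd : (D y').snd = 0 := by
    have h := congrArg WithLp.snd hfix
    rw [signOperator_apply_snd] at h
    have h2 : (2 : ℂ) • (D y').snd = 0 := by
      rw [two_smul]
      exact neg_eq_iff_add_eq_zero.mp h
    exact (smul_eq_zero.mp h2).resolve_left two_ne_zero
  have hswap : ((swapUnitary K * U : unitary _) : WithLp 2 (K × K) →L[ℂ] WithLp 2 (K × K)) y' =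
      offDiagonal 1 1 (S y' + Complex.I • D y') := by
    simp [swapUnitary, hU]
  rw [hswap, WithLp.prod_inner_apply]
  change ⟪x, (S y' + Complex.I • D y').snd⟫_ℂ + ⟪(0 : K), _⟫_ℂ = _
  rw [inner_zero_left, add_zero, WithLp.add_snd, WithLp.smul_snd, hsnd, smul_zero, add_zero]
  rfl

end Dilation

/-! ### Contractions determined by Gram matrices -/

section Gram

variable {ι H K K' : Type*} [NormedAddCommGroup H] [InnerProductSpace ℂ H]
  [NormedAddCommGroup K] [InnerProductSpace ℂ K] [NormedAddCommGroup K'] [InnerProductSpace ℂ K']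

/-- Two families of operators with the same Gram matrix are intertwined by a contraction. -/
theorem exists_contraction_of_inner_eq [CompleteSpace K] [CompleteSpace K'] (e : ι → H →L[ℂ] K)
    (e' : ι → H →L[ℂ] K')
    (h : ∀ i j x y, ⟪e i x, e j y⟫_ℂ = ⟪e' i x, e' j y⟫_ℂ) :
    ∃ T : K →L[ℂ] K', ‖T‖ ≤ 1 ∧ ∀ i x, T (e i x) = e' i x := by
  set A : (ι →₀ H) →ₗ[ℂ] K := Finsupp.lsum ℂ fun i => (e i).toLinearMap with hA
  set A' : (ι →₀ H) →ₗ[ℂ] K' := Finsupp.lsum ℂ fun i => (e' i).toLinearMap with hA'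
  have hnorm : ∀ u, ‖A' u‖ = ‖A u‖ := by
    intro u
    have : ⟪A u, A u⟫_ℂ = ⟪A' u, A' u⟫_ℂ := by
      simp only [hA, hA', Finsupp.lsum_apply, Finsupp.sum, inner_sum, sum_inner,
        ContinuousLinearMap.coe_coe, h]
    rw [@norm_eq_sqrt_re_inner ℂ, @norm_eq_sqrt_re_inner ℂ K, this]
  -- By `hnorm`, `A u ↦ A' u` is well defined and isometric; it extends to `M` by density and is set
  -- to zero on `Mᗮ`.
  set M : Submodule ℂ K := (LinearMap.range A).topologicalClosure with hM
  have hAM : ∀ u, A u ∈ M := fun u => Submodule.le_topologicalClosure _ (LinearMap.mem_range_self A u)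
  have : CompleteSpace M := (Submodule.isClosed_topologicalClosure _).completeSpace_coe
  have hdense : DenseRange (A.codRestrict M hAM) := by
    intro z
    rw [closure_subtype, ← Set.range_comp]
    exact z.2
  have hle : ∀ u, ‖A' u‖ ≤ 1 * ‖A.codRestrict M hAM u‖ := fun u => by
    rw [one_mul, hnorm]
    exact le_rfl
  refine ⟨A'.extendOfNorm (A.codRestrict M hAM) ∘L M.orthogonalProjectionOnto, ?_, fun i x => ?_⟩
  · refine (ContinuousLinearMap.opNorm_comp_le _ _).trans ?_
    exact mul_le_one₀ (LinearMap.opNorm_extendOfNorm_le hdense zero_le_one hle) (norm_nonneg _)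
      (Submodule.orthogonalProjectionOnto_norm_le M)
  · have h1 : A (Finsupp.single i x) = e i x := by simp [hA]
    have h2 : A' (Finsupp.single i x) = e' i x := by simp [hA']
    have h3 : M.orthogonalProjectionOnto (e i x) = A.codRestrict M hAM (Finsupp.single i x) := by
      rw [← h1]
      exact Submodule.orthogonalProjectionOnto_mem_subspace_eq_self (K := M) ⟨_, hAM _⟩
    rw [ContinuousLinearMap.comp_apply, h3, LinearMap.extendOfNorm_eq hdense ⟨1, hle⟩, h2]

end Gram

/-! ### Hilbert spaces of positive definite functions -/

section PositiveDefinite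

variable {H : Type u} [NormedAddCommGroup H] [InnerProductSpace ℂ H]
  {G : Type} [Group G] {S : Set G} {ψ : G → H →L[ℂ] H}

/-- The positive `2 × 2` matrix attached to `1, g` is self-adjoint; compare its off-diagonal
entries. -/
theorem IsPositiveDefiniteOn.inner_symm (hψ : IsPositiveDefiniteOn S fun g : S => ψ g)
    (h1 : (1 : G) ∈ S) {g : G} (hg : g ∈ S) (hg' : g⁻¹ ∈ S) (x y : H) :
    ⟪ψ g x, y⟫_ℂ = ⟪x, ψ g⁻¹ y⟫_ℂ := by
  have hS : ∀ i j, ((![1, g] : Fin 2 → G) i)⁻¹ * (![1, g] : Fin 2 → G) j ∈ S := by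
    intro i j
    fin_cases i <;> fin_cases j <;> simp [h1, hg, hg']
  have hpos := hψ 2 ![1, g] (fun i => by fin_cases i <;> simp [h1, hg]) hS
  have := hpos.isSymmetric (WithLp.toLp 2 ![0, x]) (WithLp.toLp 2 ![y, 0])
  simpa [PiLp.inner_apply, blockOperator_apply] using this

theorem IsPositiveDefiniteOn.sum_nonneg (hψ : IsPositiveDefiniteOn S fun g : S => ψ g)
    {ι : Type*} (f : ι → G) (hf : ∀ i, f i ∈ S) (hff : ∀ i j, (f i)⁻¹ * f j ∈ S)
    (s : Finset ι) (x : ι → H) :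
    0 ≤ ∑ i ∈ s, ∑ j ∈ s, ⟪x i, ψ ((f i)⁻¹ * f j) (x j)⟫_ℂ := by
  let σ := s.equivFin.symm
  have h := (blockOperator_isPositive_iff _).mp
    (hψ s.card (fun i => f (σ i)) (fun _ => hf _) fun _ _ => hff _ _) fun i => x (σ i)
  simp only [Matrix.of_apply] at h
  rw [← Finset.sum_coe_sort, ← σ.sum_comp]
  simp_rw [← Finset.sum_coe_sort s (fun j => ⟪x _, ψ ((f _)⁻¹ * f j) (x j)⟫_ℂ)]
  simp_rw [← σ.sum_comp (fun j : s => ⟪x _, ψ ((f _)⁻¹ * f j) (x j)⟫_ℂ)]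
  exact h

variable {K : Type u} [NormedAddCommGroup K] [InnerProductSpace ℂ K] [CompleteSpace K]
  {ι : Type} {f : ι → G} {e : ι → H →L[ℂ] K}

/-- Left translation by `a`, where defined, is implemented by a contraction. -/
theorem exists_contraction_translate
    (he : ∀ i j x y, ⟪e i x, e j y⟫_ℂ = ⟪x, ψ ((f i)⁻¹ * f j) y⟫_ℂ) (a : G) :
    ∃ T : K →L[ℂ] K, ‖T‖ ≤ 1 ∧ ∀ i j, f j = a * f i → ∀ x, T (e i x) = e j x := by
  obtain ⟨T, hT, h⟩ := exists_contraction_of_inner_eq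
    (fun p : {p : ι × ι // f p.2 = a * f p.1} => e p.1.1) (fun p => e p.1.2) (by
      rintro ⟨⟨i, i'⟩, hi⟩ ⟨⟨j, j'⟩, hj⟩ x y
      simp only at hi hj
      simp only [he, hi, hj]
      rw [mul_inv_rev, mul_assoc, inv_mul_cancel_left])
  exact ⟨T, hT, fun i j hij x => h ⟨(i, j), hij⟩ x⟩

variable [CompleteSpace H]

/-- The Hilbert space generated by a positive definite function on a family of
group elements. -/
theorem IsPositiveDefiniteOn.exists_space (hψ : IsPositiveDefiniteOn S fun g : S => ψ g)
    (h1 : (1 : G) ∈ S) (f : ι → G) (hf : ∀ i, f i ∈ S)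
    (hff : ∀ i j, (f i)⁻¹ * f j ∈ S) :
    ∃ (K : Type u) (_ : NormedAddCommGroup K) (_ : InnerProductSpace ℂ K) (_ : CompleteSpace K)
      (e : ι → H →L[ℂ] K),
      (∀ i j x y, ⟪e i x, e j y⟫_ℂ = ⟪x, ψ ((f i)⁻¹ * f j) y⟫_ℂ) ∧
      ∀ z : K, (∀ i x, ⟪e i x, z⟫_ℂ = 0) → z = 0 := by
  let κ : Matrix ι ι (H →L[ℂ] H) := Matrix.of fun i j => ψ ((f i)⁻¹ * f j)
  have hκ : κ.PosSemidef := by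
    have hiff := (RKHS.posSemidef_tfae (K := κ)).out 0 2
    refine hiff.mpr ⟨?_, fun v => ?_⟩
    · ext i j x
      refine ext_inner_left ℂ fun y => ?_
      rw [Matrix.conjTranspose_apply, ContinuousLinearMap.star_eq_adjoint,
        ContinuousLinearMap.adjoint_inner_right]
      have := hψ.inner_symm h1 (hff j i) (by simpa using hff i j) y x
      simpa [κ] using this
    · have h := hψ.sum_nonneg f hf hff v.support v
      have h' := (Complex.nonneg_iff.mp h).1
      rw [Finset.sum_comm] at h'
      simp only [Finsupp.sum, map_sum, Complex.re_sum] at h' ⊢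
      refine h'.trans_eq (Finset.sum_congr rfl fun i _ => Finset.sum_congr rfl fun j _ => ?_)
      rw [← inner_conj_symm, Complex.conj_re]
      rfl
  have : Fact κ.PosSemidef := ⟨hκ⟩
  refine ⟨RKHS.OfKernel κ, inferInstance, inferInstance, inferInstance,
    RKHS.kerFun (RKHS.OfKernel κ), fun i j x y => ?_, fun z hz => ?_⟩
  · rw [RKHS.kerFun_inner, RKHS.kerFun_apply, RKHS.OfKernel.kernel_ofKernel]
    rfl
  · refine RKHS.ext fun i => ext_inner_left ℂ fun x => ?_
    rw [← RKHS.kerFun_inner, hz]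
    simp

/-- If all the relevant quotients belong to `S`, left translation by `a` is implemented by a
contraction with prescribed matrix coefficients. -/
theorem IsPositiveDefiniteOn.exists_contraction_translate
    (hψ : IsPositiveDefiniteOn S fun g : S => ψ g)
    (h1 : (1 : G) ∈ S) (he : ∀ i j x y, ⟪e i x, e j y⟫_ℂ = ⟪x, ψ ((f i)⁻¹ * f j) y⟫_ℂ)
    (hsep : ∀ z : K, (∀ i x, ⟪e i x, z⟫_ℂ = 0) → z = 0)
    (a : G) (hf : ∀ i, f i ∈ S) (haf : ∀ i, a * f i ∈ S) (hff : ∀ i j, (f i)⁻¹ * f j ∈ S)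
    (hfaf : ∀ i j, (f i)⁻¹ * (a * f j) ∈ S) (hfaf' : ∀ i j, (a * f i)⁻¹ * f j ∈ S) :
    ∃ T : K →L[ℂ] K, ‖T‖ ≤ 1 ∧ (∀ i j, f j = a * f i → ∀ x, T (e i x) = e j x) ∧
      ∀ i j x y, ⟪e i x, T (e j y)⟫_ℂ = ⟪x, ψ ((f i)⁻¹ * (a * f j)) y⟫_ℂ := by
  -- `K` maps to `K'` in two ways, `A` onto the vectors of `f` and `B` onto those of `a * f`; their
  -- relative position is the operator `A* B`.
  obtain ⟨K', _, _, _, e', he', -⟩ := hψ.exists_space h1 (Sum.elim f fun i => a * f i)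
    (by rintro (i | i) <;> simp [hf, haf])
    (by
      rintro (i | i) (j | j)
      · exact hff i j
      · exact hfaf i j
      · exact hfaf' i j
      · simpa [mul_assoc] using hff i j)
  obtain ⟨A, hA, hAe⟩ := exists_contraction_of_inner_eq e (fun i => e' (Sum.inl i))
    (fun i j x y => by rw [he, he']; rfl)
  obtain ⟨B, hB, hBe⟩ := exists_contraction_of_inner_eq e (fun i => e' (Sum.inr i))
    (fun i j x y => by rw [he, he']; simp [mul_assoc])
  have key : ∀ i j x y, ⟪e i x, (ContinuousLinearMap.adjoint A ∘L B) (e j y)⟫_ℂ =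
      ⟪x, ψ ((f i)⁻¹ * (a * f j)) y⟫_ℂ := by
    intro i j x y
    rw [ContinuousLinearMap.comp_apply, ContinuousLinearMap.adjoint_inner_right, hAe, hBe, he']
    rfl
  refine ⟨ContinuousLinearMap.adjoint A ∘L B, ?_, fun i j hij x => ?_, key⟩
  · refine (ContinuousLinearMap.opNorm_comp_le _ _).trans (mul_le_one₀ ?_ (norm_nonneg _) hB)
    rwa [LinearIsometryEquiv.norm_map]
  · refine sub_eq_zero.mp (hsep _ fun k y => ?_)
    rw [inner_sub_right, key, he, hij, sub_self]

end PositiveDefinite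

/-! ### The free group -/

section FreeGroup

theorem FreeGroup.exists_list_length_le {m n : ℕ} {g : FreeGroup (Fin m)}
    (hg : g ∈ wordBall m n) : ∃ L : List (Fin m × Bool), L.length ≤ n ∧ FreeGroup.mk L = g :=
  ⟨g.toWord, hg, FreeGroup.mk_toWord⟩

theorem mk_mem_wordBall {m n : ℕ} {L : List (Fin m × Bool)} (hL : L.length ≤ n) :
    FreeGroup.mk L ∈ wordBall m n :=
  FreeGroup.norm_mk_le.trans hL

theorem mul_mem_wordBall {m k l n : ℕ} {g h : FreeGroup (Fin m)} (hg : g ∈ wordBall m k)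
    (hh : h ∈ wordBall m l) (hn : k + l ≤ n) : g * h ∈ wordBall m n :=
  (FreeGroup.norm_mul_le g h).trans ((add_le_add hg hh).trans hn)

theorem inv_mem_wordBall {m n : ℕ} {g : FreeGroup (Fin m)} (hg : g ∈ wordBall m n) :
    g⁻¹ ∈ wordBall m n := by
  change g⁻¹.norm ≤ n
  rwa [FreeGroup.norm_inv_eq]

theorem one_mem_wordBall (m n : ℕ) : (1 : FreeGroup (Fin m)) ∈ wordBall m n := by
  simp [wordBall]

theorem wordBall_mono {m k n : ℕ} (h : k ≤ n) : wordBall m k ⊆ wordBall m n :=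
  fun _ hg => le_trans hg h

theorem of_mem_wordBall {m : ℕ} (a : Fin m) : FreeGroup.of a ∈ wordBall m 1 :=
  (FreeGroup.norm_of a).le

theorem FreeGroup.mk_cons {α : Type*} (p : α × Bool) (L : List (α × Bool)) :
    FreeGroup.mk (p :: L) = FreeGroup.mk [p] * FreeGroup.mk L := by
  simp

theorem FreeGroup.mk_singleton_false {α : Type*} (a : α) :
    FreeGroup.mk [(a, false)] = (FreeGroup.of a)⁻¹ := rfl

/-- A unitary operator maps `W z` to `W (T z)` if `T` is its compression along the isometry `W`
and `T` preserves the norm of `z`. -/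
theorem unitary_apply_eq_of_norm_eq {K L : Type*} [NormedAddCommGroup K] [InnerProductSpace ℂ K]
    [NormedAddCommGroup L] [InnerProductSpace ℂ L] [CompleteSpace L] (W : K →ₗᵢ[ℂ] L)
    (U : unitary (L →L[ℂ] L)) (T : K →L[ℂ] K)
    (hU : ∀ x y, ⟪W x, (U : L →L[ℂ] L) (W y)⟫_ℂ = ⟪x, T y⟫_ℂ) {z : K} (hz : ‖T z‖ = ‖z‖) :
    (U : L →L[ℂ] L) (W z) = W (T z) := by
  have hn : ‖(U : L →L[ℂ] L) (W z)‖ = ‖z‖ := by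
    rw [ContinuousLinearMap.norm_map_of_mem_unitary U.2, W.norm_map]
  rw [← sub_eq_zero, ← norm_eq_zero, ← sq_eq_zero_iff, @norm_sub_sq ℂ, hn, W.norm_map, hz,
    ← inner_conj_symm, hU, RCLike.conj_re, inner_self_eq_norm_sq, hz]
  ring

variable {H : Type u} [NormedAddCommGroup H] [InnerProductSpace ℂ H] [CompleteSpace H]

/-- A positive definite function on a ball of the free group is a matrix coefficient of a unitary
representation. -/
theorem exists_unitary_representation {m n : ℕ} {ψ : FreeGroup (Fin m) → H →L[ℂ] H}
    (hψ : IsPositiveDefiniteOn (wordBall m n) fun g : wordBall m n => ψ g) :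
    ∃ (K : Type u) (_ : NormedAddCommGroup K) (_ : InnerProductSpace ℂ K) (_ : CompleteSpace K)
      (π : FreeGroup (Fin m) →* unitary (K →L[ℂ] K)) (V : H →L[ℂ] K),
      ∀ g ∈ wordBall m n, ∀ x y, ⟪V x, (π g : K →L[ℂ] K) (V y)⟫_ℂ = ⟪x, ψ g y⟫_ℂ := by
  set r := n / 2 with hr
  have h1 := one_mem_wordBall m n
  have hff : ∀ s t : wordBall m r, (s : FreeGroup (Fin m))⁻¹ * t ∈ wordBall m n := fun s t =>
    mul_mem_wordBall (inv_mem_wordBall s.2) t.2 (by omega)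
  have hf : ∀ s : wordBall m r, (s : FreeGroup (Fin m)) ∈ wordBall m n := fun s =>
    wordBall_mono (by omega) s.2
  obtain ⟨K, _, _, _, e, he, hsep⟩ := hψ.exists_space h1 (fun s : wordBall m r => (s : FreeGroup _))
    hf hff
  have hT : ∀ a : Fin m, ∃ T : K →L[ℂ] K, ‖T‖ ≤ 1 ∧
      (∀ s t : wordBall m r, (t : FreeGroup (Fin m)) = FreeGroup.of a * s →
        ∀ x, T (e s x) = e t x) ∧
      (2 * r + 1 ≤ n → ∀ s t x y, ⟪e s x, T (e t y)⟫_ℂ =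
        ⟪x, ψ ((s : FreeGroup (Fin m))⁻¹ * (FreeGroup.of a * t)) y⟫_ℂ) := by
    intro a
    by_cases hn : 2 * r + 1 ≤ n
    · have haf : ∀ s : wordBall m r, FreeGroup.of a * (s : FreeGroup (Fin m)) ∈
          wordBall m (r + 1) := fun s =>
        mul_mem_wordBall (of_mem_wordBall a) s.2 (by omega)
      obtain ⟨T, hT, h, h'⟩ := hψ.exists_contraction_translate h1 he hsep (FreeGroup.of a) hf
        (fun s => wordBall_mono (by omega) (haf s)) hff
        (fun s t => mul_mem_wordBall (inv_mem_wordBall s.2) (haf t) (by omega))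
        (fun s t => mul_mem_wordBall (inv_mem_wordBall (haf s)) t.2 (by omega))
      exact ⟨T, hT, h, fun _ => h'⟩
    · obtain ⟨T, hT, h⟩ := exists_contraction_translate he (FreeGroup.of a)
      exact ⟨T, hT, h, fun h' => absurd h' hn⟩
  choose T hT hTe hTi using hT
  choose U hU using fun a => exists_unitary_dilation (T a) (hT a)
  let W : K →ₗᵢ[ℂ] WithLp 2 (K × K) :=
    { toLinearMap := (WithLp.linearEquiv 2 ℂ (K × K)).symm.toLinearMap ∘ₗ LinearMap.inl ℂ K K
      norm_map' := fun x => WithLp.norm_toLp_fst 2 K K x }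
  replace hU : ∀ a x y, ⟪W x, (U a : WithLp 2 (K × K) →L[ℂ] WithLp 2 (K × K)) (W y)⟫_ℂ =
    ⟪x, T a y⟫_ℂ := hU
  -- The norm does not depend on `s`, so `T a` preserves it on `e s x` whenever `a s` stays in the
  -- ball.
  have hnorm : ∀ s x, ‖e s x‖ ^ 2 = RCLike.re ⟪x, ψ 1 x⟫_ℂ := by
    intro s x
    rw [← inner_self_eq_norm_sq (𝕜 := ℂ), he, inv_mul_cancel]
  have hUe : ∀ (a : Fin m) (s t : wordBall m r), (t : FreeGroup (Fin m)) = FreeGroup.of a * s →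
      ∀ x, (U a : WithLp 2 (K × K) →L[ℂ] WithLp 2 (K × K)) (W (e s x)) = W (e t x) := by
    intro a s t hst x
    rw [← hTe a s t hst]
    refine unitary_apply_eq_of_norm_eq W (U a) (T a) (hU a) ?_
    rw [hTe a s t hst, ← sq_eq_sq₀ (norm_nonneg _) (norm_nonneg _), hnorm, hnorm]
  let π : FreeGroup (Fin m) →* unitary (WithLp 2 (K × K) →L[ℂ] WithLp 2 (K × K)) :=
    FreeGroup.lift U
  have hπof : ∀ a, π (FreeGroup.of a) = U a := fun a => FreeGroup.lift_apply_of
  have hπmul : ∀ g h z, (π (g * h) : WithLp 2 (K × K) →L[ℂ] WithLp 2 (K × K)) z =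
      (π g : WithLp 2 (K × K) →L[ℂ] WithLp 2 (K × K))
        ((π h : WithLp 2 (K × K) →L[ℂ] WithLp 2 (K × K)) z) := by
    intro g h z
    rw [map_mul]
    rfl
  have hπinv : ∀ g z w, (π g : WithLp 2 (K × K) →L[ℂ] WithLp 2 (K × K)) z = w →
      (π g⁻¹ : WithLp 2 (K × K) →L[ℂ] WithLp 2 (K × K)) w = z := by
    intro g z w h
    rw [← h, ← hπmul, inv_mul_cancel, map_one]
    rfl
  have hπinner : ∀ g z w, ⟪z, (π g : WithLp 2 (K × K) →L[ℂ] WithLp 2 (K × K)) w⟫_ℂ =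
      ⟪(π g⁻¹ : WithLp 2 (K × K) →L[ℂ] WithLp 2 (K × K)) z, w⟫_ℂ := by
    intro g z w
    rw [map_inv, ← Unitary.star_eq_inv, Unitary.coe_star, ContinuousLinearMap.star_eq_adjoint,
      ContinuousLinearMap.adjoint_inner_left]
  have hball : ∀ (L : List (Fin m × Bool)) (hL : L.length ≤ r) (x : H),
      (π (FreeGroup.mk L) : WithLp 2 (K × K) →L[ℂ] WithLp 2 (K × K))
        (W (e ⟨1, one_mem_wordBall m r⟩ x)) = W (e ⟨FreeGroup.mk L, mk_mem_wordBall hL⟩ x) := by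
    intro L
    induction L with
    | nil =>
      intro hL x
      change (π 1 : WithLp 2 (K × K) →L[ℂ] WithLp 2 (K × K)) _ = _
      rw [map_one]
      rfl
    | cons p L ih =>
      intro hL x
      have hL' : L.length ≤ r := by
        rw [List.length_cons] at hL
        omega
      rw [congrArg π (FreeGroup.mk_cons p L), hπmul, ih hL']
      obtain ⟨a, _ | _⟩ := p
      · refine hπinv (FreeGroup.of a) _ _ ?_
        rw [hπof]
        refine hUe a _ _ ?_ x
        simp only [FreeGroup.mk_cons (a, false) L, FreeGroup.mk_singleton_false,
          mul_inv_cancel_left]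
      · change (π (FreeGroup.of a) : WithLp 2 (K × K) →L[ℂ] WithLp 2 (K × K)) _ = _
        rw [hπof]
        exact hUe a _ _ (FreeGroup.mk_cons _ _) x
  have hball' : ∀ (g : FreeGroup (Fin m)) (hg : g ∈ wordBall m r) (x : H),
      (π g : WithLp 2 (K × K) →L[ℂ] WithLp 2 (K × K)) (W (e ⟨1, one_mem_wordBall m r⟩ x)) =
        W (e ⟨g, hg⟩ x) := by
    intro g hg x
    obtain ⟨L, hL, rfl⟩ := FreeGroup.exists_list_length_le hg
    exact hball L hL x
  refine ⟨WithLp 2 (K × K), inferInstance, inferInstance, inferInstance, π,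
    W.toContinuousLinearMap ∘L e ⟨1, one_mem_wordBall m r⟩, fun g hg x y => ?_⟩
  change ⟪W (e ⟨1, one_mem_wordBall m r⟩ x), (π g : WithLp 2 (K × K) →L[ℂ] WithLp 2 (K × K))
    (W (e ⟨1, one_mem_wordBall m r⟩ y))⟫_ℂ = _
  obtain ⟨L, hL, rfl⟩ := FreeGroup.exists_list_length_le hg
  -- The prefix of length at most `r` moves to the left of the inner product, inverted.
  have hs := inv_mem_wordBall (mk_mem_wordBall (L := L.take r) (n := r) (by simp))
  rw [← List.take_append_drop r L, ← FreeGroup.mul_mk, hπmul, hπinner, hball' _ hs]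
  -- A suffix longer than `r` forces `n = 2r + 1`; its first letter is the middle one.
  rcases le_or_gt (L.drop r).length r with hd | hd
  · rw [hball _ hd, W.inner_map_map, he, inv_inv]
  · have hn : 2 * r + 1 ≤ n := by
      rw [List.length_drop] at hd
      omega
    obtain ⟨⟨a, b⟩, L', hL'⟩ : ∃ p L', L.drop r = p :: L' :=
      List.exists_cons_of_length_pos (by omega)
    have hlen : L'.length ≤ r := by
      have := congrArg List.length hL'
      rw [List.length_drop, List.length_cons] at this
      omega
    rw [hL', FreeGroup.mk_cons, hπmul, hball _ hlen]
    cases b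
    -- Only `T a` has known coefficients, so the letter `a⁻¹` is handled by taking adjoints.
    · rw [FreeGroup.mk_singleton_false, hπinner, inv_inv, hπof, ← inner_conj_symm, hU,
        hTi a hn, inner_conj_symm, hψ.inner_symm h1]
      · simp [mul_assoc]
      · exact mul_mem_wordBall (inv_mem_wordBall (mk_mem_wordBall hlen))
          (mul_mem_wordBall (of_mem_wordBall a) hs le_rfl) (by omega)
      · exact inv_mem_wordBall (mul_mem_wordBall (inv_mem_wordBall (mk_mem_wordBall hlen))
          (mul_mem_wordBall (of_mem_wordBall a) hs le_rfl) (by omega))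
    · change ⟪_, (π (FreeGroup.of a) : WithLp 2 (K × K) →L[ℂ] WithLp 2 (K × K)) _⟫_ℂ = _
      rw [hπof, hU, hTi a hn, inv_inv]
      rfl

end FreeGroup

theorem corollary4p6 {H : Type u} [NormedAddCommGroup H] [InnerProductSpace ℂ H]
    [CompleteSpace H] (m n : ℕ) (φ : wordBall m n → H →L[ℂ] H)
    (hφ : IsPositiveDefiniteOn (wordBall m n) φ) :
    ∃ (K : Type u) (_ : NormedAddCommGroup K) (_ : InnerProductSpace ℂ K) (_ : CompleteSpace K)
      (π : FreeGroup (Fin m) →* unitary (K →L[ℂ] K)) (V : H →L[ℂ] K),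
      ∀ (s t : FreeGroup (Fin m)) (hst : s⁻¹ * t ∈ wordBall m n),
        φ ⟨s⁻¹ * t, hst⟩ =
          ContinuousLinearMap.adjoint V ∘L (π (s⁻¹ * t) : K →L[ℂ] K) ∘L V := by
  classical
  let ψ : FreeGroup (Fin m) → H →L[ℂ] H := fun g =>
    if h : g ∈ wordBall m n then φ ⟨g, h⟩ else 0
  have hψφ : (fun g : wordBall m n => ψ g) = φ := by
    ext1 g
    exact dif_pos g.2
  obtain ⟨K, i1, i2, i3, π, V, hV⟩ := exists_unitary_representation (ψ := ψ) (hψφ ▸ hφ)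
  refine ⟨K, i1, i2, i3, π, V, fun s t hst => ?_⟩
  ext y
  refine ext_inner_left ℂ fun x => ?_
  rw [ContinuousLinearMap.comp_apply, ContinuousLinearMap.adjoint_inner_right,
    ContinuousLinearMap.comp_apply, hV _ hst]
  rw [← congrFun hψφ ⟨s⁻¹ * t, hst⟩]
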